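/- Let $m\ge 1$, $n\ge 3$, let $A_k,B_k,C_k\in\mathbb C^{m\times m}$ ($k=1,\dots,n$) with all $B_k$ and $C_k$ invertible, and let $E\in\mathbb C$. Put $$t_k(E)=\begin{pmatrix} B_k^{-1}(E-A_k) & -B_k^{-1}C_k\\ I_m&0\end{pmatrix},\qquad T(E)=t_n(E)\cdots t_1(E)\in\mathbb C^{2m\times 2m},$$ and let $h\in\mathbb C^{nm\times nm}$ be the block tridiagonal matrix with diagonal blocks $h_{k,k}=A_k$, upper blocks $h_{k,k+1}=B_k$ and lower blocks $h_{k,k-1}=C_k$ (open boundary conditions; $C_1$ and $B_n$ do not occur in $h$). Suppose that $E$ is not an eigenvalue of $h$. With $\|\cdot\|$ the operator norm for the Euclidean norm and $\mathrm{cond}(M)=\|M\|\,\|M^{-1}\|$, put $$q=\frac{\mathrm{cond}(h-E)-1}{\mathrm{cond}(h-E)+1},\qquad C=\frac{(\mathrm{cond}(h-E)+1)^2}{2\|h-E\|^2},$$ $$K_1=m\,\|B_n\|\,C\,(\|A_1-E\|+\|C_2\|)\,q^{-3/2},\qquad K_2=m\,\|C_1\|\,C\,(\|A_n-E\|+\|B_{n-1}\|)\,q^{-3/2},\qquad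 K=\max(K_1,K_2).$$ Singular values are counted with multiplicity. Then: (i) $0<q<1$, and $T(E)$ has at least $m$ singular values larger than $q^{-n/2}/K_1$ and at least $m$ singular values smaller than $K_2\,q^{n/2}$. (ii) If $n$ is so large that $K_1K_2\,q^{n}\le 1$, then $T(E)$ has exactly $m$ singular values larger than $q^{-n/2}/K_1$ and exactly $m$ singular values smaller than $K_2\,q^{n/2}$. (iii) If $n$ is so large that $K q^{n/2}\le 1$, then $T(E)$ has exactly $m$ singular values larger than $q^{-n/2}/K$ and exactly $m$ singular values smaller than $K q^{n/2}$. (iv) In particular, for all real $q_0<1$ and $K_0$ there is an $N$ such that the conclusion of (iii) holds for all $n\ge N$, all $m\ge 1$ and all chains and $E$ as above with $q\le q_0$ and $K\le K_0$. -/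

import Mathlib

open scoped Matrix Matrix.Norms.L2Operator

noncomputable section

namespace TransferMatrix

/-! The chain `C k u (k-1) + A k u k + B k u (k+1) = E u k`, `k = 1, …, n`, with blocks of size `m`.
The blocks are given as sequences indexed by `ℕ`, of which only the entries `1, …, n` are used.
Norms of matrices are operator norms for the Euclidean norm. -/

/-- The one-step transfer matrix `t k (E)`, which maps `(u k, u (k-1))` to `(u (k+1), u k)`. -/
def step {m : ℕ} (A B C : ℕ → Matrix (Fin m) (Fin m) ℂ) (E : ℂ) (k : ℕ) :
    Matrix (Fin m ⊕ Fin m) (Fin m ⊕ Fin m) ℂ :=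
  Matrix.fromBlocks ((B k)⁻¹ * (Matrix.scalar (Fin m) E - A k)) (-((B k)⁻¹ * C k)) 1 0

/-- The `n`-step transfer matrix `T(E) = t n (E) ⋯ t 1 (E)`. -/
def transfer {m : ℕ} (A B C : ℕ → Matrix (Fin m) (Fin m) ℂ) (E : ℂ) :
    ℕ → Matrix (Fin m ⊕ Fin m) (Fin m ⊕ Fin m) ℂ
  | 0 => 1
  | k + 1 => step A B C E (k + 1) * transfer A B C E k

/-- The block tridiagonal matrix `h` of the chain with open boundary conditions: its block row
`k` (for `k = 1, …, n`, here shifted to `0, …, n - 1`) is `(…, C k, A k, B k, …)`, with `A k` on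
the diagonal. -/
def openChain {m : ℕ} (n : ℕ) (A B C : ℕ → Matrix (Fin m) (Fin m) ℂ) :
    Matrix (Fin n × Fin m) (Fin n × Fin m) ℂ :=
  Matrix.of fun i j =>
    if j.1 = i.1 then A (i.1 + 1) i.2 j.2
    else if (j.1 : ℕ) = i.1 + 1 then B (i.1 + 1) i.2 j.2
    else if (i.1 : ℕ) = j.1 + 1 then C (i.1 + 1) i.2 j.2
    else 0

/-- `h - E`. -/
def shifted {m : ℕ} (n : ℕ) (A B C : ℕ → Matrix (Fin m) (Fin m) ℂ) (E : ℂ) :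
    Matrix (Fin n × Fin m) (Fin n × Fin m) ℂ :=
  openChain n A B C - Matrix.scalar (Fin n × Fin m) E

/-- The condition number `‖M‖ ‖M⁻¹‖`. -/
def cond {ι : Type*} [Fintype ι] [DecidableEq ι] (M : Matrix ι ι ℂ) : ℝ :=
  ‖M‖ * ‖M⁻¹‖

/-- The Demko–Moss–Smith decay rate `q = (cond M - 1) / (cond M + 1)`. -/
def dmsQ {ι : Type*} [Fintype ι] [DecidableEq ι] (M : Matrix ι ι ℂ) : ℝ :=
  (cond M - 1) / (cond M + 1)

/-- The Demko–Moss–Smith constant `C = (cond M + 1)² / (2 ‖M‖²)`. -/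
def dmsC {ι : Type*} [Fintype ι] [DecidableEq ι] (M : Matrix ι ι ℂ) : ℝ :=
  (cond M + 1) ^ 2 / (2 * ‖M‖ ^ 2)

/-- The rate `q` of the matrix `h - E`. -/
def rate {m : ℕ} (n : ℕ) (A B C : ℕ → Matrix (Fin m) (Fin m) ℂ) (E : ℂ) : ℝ :=
  dmsQ (shifted n A B C E)

/-- The constant `m ‖B n‖ C (‖A 1 - E‖ + ‖C 2‖) q ^ (-3/2)`. -/
def constK {m : ℕ} (n : ℕ) (A B C : ℕ → Matrix (Fin m) (Fin m) ℂ) (E : ℂ) : ℝ :=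
  m * ‖B n‖ * dmsC (shifted n A B C E) *
    (‖A 1 - Matrix.scalar (Fin m) E‖ + ‖C 2‖) * rate n A B C E ^ (-(3 / 2) : ℝ)

/-- The same constant for the inverted chain (order of the blocks reversed, `B` and `C`
exchanged): `m ‖C 1‖ C (‖A n - E‖ + ‖B (n-1)‖) q ^ (-3/2)`. Inversion changes neither
`‖h - E‖` nor `cond (h - E)`. -/
def constKInv {m : ℕ} (n : ℕ) (A B C : ℕ → Matrix (Fin m) (Fin m) ℂ) (E : ℂ) : ℝ :=
  m * ‖C 1‖ * dmsC (shifted n A B C E) *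
    (‖A n - Matrix.scalar (Fin m) E‖ + ‖B (n - 1)‖) * rate n A B C E ^ (-(3 / 2) : ℝ)

/-- The larger of the two constants. -/
def constMax {m : ℕ} (n : ℕ) (A B C : ℕ → Matrix (Fin m) (Fin m) ℂ) (E : ℂ) : ℝ :=
  max (constK n A B C E) (constKInv n A B C E)

/-- The singular values of a square matrix in decreasing order, with multiplicity; the entries
with index `0, …, card ι - 1` are the square roots of the eigenvalues of `Mᴴ M`. -/
def singVal {ι : Type*} [Fintype ι] [DecidableEq ι] (M : Matrix ι ι ℂ) : ℕ → ℝ :=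
  (Matrix.toEuclideanLin M).singularValues

/-- The number of singular values larger than `x`, with multiplicity. -/
def numGT {ι : Type*} [Fintype ι] [DecidableEq ι] (M : Matrix ι ι ℂ) (x : ℝ) : ℕ :=
  ((Finset.range (Fintype.card ι)).filter fun i => x < singVal M i).card

/-- The number of singular values smaller than `x`, with multiplicity. -/
def numLT {ι : Type*} [Fintype ι] [DecidableEq ι] (M : Matrix ι ι ℂ) (x : ℝ) : ℕ :=
  ((Finset.range (Fintype.card ι)).filter fun i => singVal M i < x).card

end TransferMatrix

end

/-! Let `u` solve the recursion, so that T(E) maps (u_1, u_0) to (u_{n+1}, u_n). Restricted to sites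
1, …, n, the recursion says that (h - E)u has only two source terms, -C_1 u_0 in the first block and
-B_n u_{n+1} in the last. With G = (h - E)⁻¹, initial data with u_0 = 0 satisfy u_1 = -G_{1n} B_n
u_{n+1}, and solutions with u_{n+1} = 0 satisfy u_n = -G_{n1} C_1 u_0. A small corner block of G
thus yields an m-dimensional space that T(E) expands, the opposite corner one that it contracts
(`le_numGT_transfer`, `le_numLT_transfer`). A min-max argument turns these spaces into counts of
singular values. As there are 2m in all, both counts are exact once the two thresholds are in order.

The corners are small by the Demko–Moss–Smith argument. Since M = h - E need not be Hermitian, it is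
applied to M Mᴴ: a polynomial of degree d in M Mᴴ has block bandwidth 2d, so outside this band the
blocks of (M Mᴴ)⁻¹ are bounded by the error of approximating 1/y by polynomials of degree d on an
interval containing the spectrum (`exists_polynomial_approx_inv`,
`norm_block_inv_mul_conjTranspose_le`). The identity M⁻¹ = Mᴴ (M Mᴴ)⁻¹ carries the decay over to G
(`norm_block_inv_le`). -/

namespace TransferMatrix

/-! ### Chebyshev approximation of 1/y on an interval -/

section Approximation

open Polynomial

/-- This is T_k(cos θ) = cos kθ with ρ in place of e^{iθ}; it evaluates the error numerator at the
pole. -/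
theorem chebyshevT_eval_half_add_inv {ρ : ℝ} (hρ : ρ ≠ 0) (k : ℤ) :
    (Chebyshev.T ℝ k).eval ((ρ + ρ⁻¹) / 2) = (ρ ^ k + ρ ^ (-k)) / 2 := by
  induction k using Polynomial.Chebyshev.induct with
  | zero => simp
  | one => simp
  | add_two k h1 h0 =>
    rw [Chebyshev.T_add_two]
    simp only [eval_sub, eval_mul, eval_X, eval_ofNat, h1, h0]
    have e1 : ρ ^ ((k : ℤ) + 2) = ρ ^ (k : ℤ) * ρ ^ 2 := by
      rw [zpow_add₀ hρ]; norm_cast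
    have e2 : ρ ^ ((k : ℤ) + 1) = ρ ^ (k : ℤ) * ρ := zpow_add_one₀ hρ _
    rw [zpow_neg, zpow_neg, zpow_neg, e1, e2]
    have := zpow_ne_zero (k : ℤ) hρ
    field_simp
    ring
  | neg_add_one k h0 h1 =>
    have h := Chebyshev.T_sub_one ℝ (-(k : ℤ))
    rw [h]
    simp only [eval_sub, eval_mul, eval_X, eval_ofNat, h1, h0]
    have e1 : ρ ^ (-(k : ℤ) + 1) = ρ ^ (-(k : ℤ)) * ρ := zpow_add_one₀ hρ _
    have e2 : ρ ^ (-(k : ℤ) - 1) = ρ ^ (-(k : ℤ)) * ρ⁻¹ := zpow_sub_one₀ hρ _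
    rw [zpow_neg ρ (-(k : ℤ) + 1), zpow_neg ρ (-(k : ℤ) - 1), zpow_neg ρ (-(k : ℤ)), e1, e2]
    have := zpow_ne_zero (-(k : ℤ)) hρ
    field_simp
    ring

/-- The numerator of the error of best approximation to `1 / (a - x)` on `[-1, 1]`. -/
noncomputable def errorNumerator (ρ : ℝ) (d : ℕ) : ℝ[X] :=
  Chebyshev.T ℝ (d + 1) - C (2 * ρ) * Chebyshev.T ℝ d + C (ρ ^ 2) * Chebyshev.T ℝ (d - 1)

theorem natDegree_errorNumerator_le (ρ : ℝ) (d : ℕ) :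
    (errorNumerator ρ d).natDegree ≤ d + 1 := by
  unfold errorNumerator
  refine (natDegree_add_le _ _).trans (max_le ((natDegree_sub_le _ _).trans (max_le ?_ ?_)) ?_)
  · rw [Chebyshev.natDegree_T]; omega
  · refine (natDegree_C_mul_le _ _).trans ?_
    rw [Chebyshev.natDegree_T]; omega
  -- The index `d - 1` is an integer: for d = 0 the polynomial is T_{-1} = T_1, still of degree at
  -- most d + 1.
  · refine (natDegree_C_mul_le _ _).trans ?_
    rw [Chebyshev.natDegree_T]; omega

theorem errorNumerator_eval_pole {ρ : ℝ} (hρ : ρ ≠ 0) (d : ℕ) :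
    (errorNumerator ρ d).eval ((ρ + ρ⁻¹) / 2) = (1 - ρ ^ 2) ^ 2 / (2 * ρ ^ (d + 1)) := by
  simp only [errorNumerator, eval_add, eval_sub, eval_mul, eval_C,
    chebyshevT_eval_half_add_inv hρ]
  have e1 : ρ ^ ((d : ℤ) + 1) = ρ ^ d * ρ := by rw [zpow_add_one₀ hρ]; norm_cast
  have e2 : ρ ^ ((d : ℤ) - 1) = ρ ^ d * ρ⁻¹ := by rw [zpow_sub_one₀ hρ]; norm_cast
  rw [zpow_neg, zpow_neg, zpow_neg, e1, e2, zpow_natCast, pow_succ]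
  have := pow_ne_zero d hρ
  field_simp
  ring

/-- At x = cos θ the numerator is the real part of e^{i(d-1)θ} (e^{iθ} - ρ)², whose modulus is
|e^{iθ} - ρ|² = 1 + ρ² - 2ρx. -/
theorem abs_errorNumerator_eval_le (ρ : ℝ) (d : ℕ) {x : ℝ} (h1 : -1 ≤ x) (h2 : x ≤ 1) :
    |(errorNumerator ρ d).eval x| ≤ 1 + ρ ^ 2 - 2 * ρ * x := by
  obtain ⟨θ, rfl⟩ : ∃ θ, Real.cos θ = x := ⟨Real.arccos x, Real.cos_arccos h1 h2⟩
  simp only [errorNumerator, eval_add, eval_sub, eval_mul, eval_C, Chebyshev.T_real_cos]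
  push_cast
  rw [add_mul, sub_mul, one_mul, Real.cos_add, Real.cos_sub]
  set c := Real.cos θ
  set s := Real.sin θ
  set D := Real.cos (d * θ)
  set S := Real.sin (d * θ)
  have hcs : s ^ 2 + c ^ 2 = 1 := Real.sin_sq_add_cos_sq θ
  have hDS : S ^ 2 + D ^ 2 = 1 := Real.sin_sq_add_cos_sq _
  have hpos : 0 ≤ 1 + ρ ^ 2 - 2 * ρ * c := by nlinarith [sq_nonneg (ρ - c), sq_nonneg s]
  refine abs_le_of_sq_le_sq ?_ hpos
  have key : (1 + ρ ^ 2 - 2 * ρ * c) ^ 2 =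
      (c * (1 + ρ ^ 2) - 2 * ρ) ^ 2 + (s * (1 - ρ ^ 2)) ^ 2 := by
    have : s ^ 2 = 1 - c ^ 2 := by linarith
    rw [mul_pow, this]; ring
  -- Lagrange's identity: squared modulus minus squared real part is the squared imaginary part.
  have h3 : (1 + ρ ^ 2 - 2 * ρ * c) ^ 2 -
      (D * c - S * s - 2 * ρ * D + ρ ^ 2 * (D * c + S * s)) ^ 2 =
      (S * (c * (1 + ρ ^ 2) - 2 * ρ) + D * (s * (1 - ρ ^ 2))) ^ 2 := by
    have h4 := congrArg (· * ((c * (1 + ρ ^ 2) - 2 * ρ) ^ 2 + (s * (1 - ρ ^ 2)) ^ 2)) hDS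
    rw [key]
    linear_combination (-1 : ℝ) * h4
  nlinarith [sq_nonneg (S * (c * (1 + ρ ^ 2) - 2 * ρ) + D * (s * (1 - ρ ^ 2)))]

/-- Chebyshev's approximation of `1 / (a - x)` by polynomials of degree `d` on `[-1, 1]`. -/
theorem exists_polynomial_approx_inv_sub {ρ : ℝ} (h0 : 0 < ρ) (h1 : ρ < 1) (d : ℕ) :
    ∃ P : ℝ[X], P.natDegree ≤ d ∧ ∀ x : ℝ, -1 ≤ x → x ≤ 1 →
      |((ρ + ρ⁻¹) / 2 - x)⁻¹ - P.eval x| ≤ 4 * ρ ^ (d + 2) / (1 - ρ ^ 2) ^ 2 := by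
  set a := (ρ + ρ⁻¹) / 2 with ha
  set N := errorNumerator ρ d
  have hNa : N.eval a = (1 - ρ ^ 2) ^ 2 / (2 * ρ ^ (d + 1)) := errorNumerator_eval_pole h0.ne' d
  have hr : 0 < 1 - ρ ^ 2 := by nlinarith
  have hNpos : 0 < N.eval a := by rw [hNa]; positivity
  have ha1 : 2 * ρ * a = 1 + ρ ^ 2 := by rw [ha]; field_simp; ring
  -- With P = R / N(a) the error is N(x) / ((a - x) N(a)). The bound |N(x)| ≤ 2ρ(a - x) cancels the
  -- factor a - x.
  obtain ⟨R, hR⟩ : X - C a ∣ N - C (N.eval a) := X_sub_C_dvd_sub_C_eval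
  refine ⟨C (N.eval a)⁻¹ * R, (natDegree_C_mul_le _ _).trans ?_, fun x hx1 hx2 => ?_⟩
  · by_cases hR0 : R = 0
    · simp [hR0]
    have h := congrArg natDegree hR
    rw [(monic_X_sub_C a).natDegree_mul' hR0, natDegree_X_sub_C] at h
    have h' : (N - C (N.eval a)).natDegree ≤ d + 1 := by
      rw [natDegree_sub_C]; exact natDegree_errorNumerator_le ρ d
    omega
  · have hax : 0 < a - x := by
      have : 0 < 2 * ρ * (a - x) := by rw [mul_sub, ha1]; nlinarith [sq_nonneg (1 - ρ)]
      exact pos_of_mul_pos_right this (by positivity)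
    have hRx : N.eval x - N.eval a = (x - a) * R.eval x := by
      simpa using congrArg (eval x) hR
    have e : (a - x)⁻¹ - (C (N.eval a)⁻¹ * R).eval x = N.eval x / ((a - x) * N.eval a) := by
      rw [eval_mul, eval_C, sub_eq_iff_eq_add.mp hRx]
      field_simp
      ring
    rw [e, abs_div, abs_of_pos (mul_pos hax hNpos), div_le_iff₀ (mul_pos hax hNpos), hNa]
    refine (abs_errorNumerator_eval_le ρ d hx1 hx2).trans (le_of_eq ?_)
    rw [← ha1]
    field_simp
    ring

/-- Approximation of `1 / y` by polynomials of degree `d` on `[a², b²]`. -/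
theorem exists_polynomial_approx_inv {a b : ℝ} (ha : 0 < a) (hab : a < b) (d : ℕ) :
    ∃ P : ℝ[X], P.natDegree ≤ d ∧ ∀ y : ℝ, a ^ 2 ≤ y → y ≤ b ^ 2 →
      |y⁻¹ - P.eval y| ≤
        (b / a + 1) ^ 2 / (2 * b ^ 2) * ((b / a - 1) / (b / a + 1)) ^ (d + 1) := by
  have hb : 0 < b := ha.trans hab
  set ρ := (b / a - 1) / (b / a + 1) with hρ
  have hρ' : ρ = (b - a) / (b + a) := by rw [hρ]; field_simp
  have hba : 0 < b - a := sub_pos.mpr hab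
  have h0 : 0 < ρ := by rw [hρ']; positivity
  have h1 : ρ < 1 := by rw [hρ', div_lt_one (by positivity)]; linarith
  obtain ⟨P, hP, hPx⟩ := exists_polynomial_approx_inv_sub h0 h1 d
  have hs : 0 < b ^ 2 - a ^ 2 := by nlinarith
  -- The decreasing affine map of [a², b²] onto [-1, 1] sends the pole y = 0 to (ρ + ρ⁻¹)/2 with ρ =
  -- (b - a)/(b + a).
  refine ⟨C (2 / (b ^ 2 - a ^ 2)) *
    P.comp (C (-2 / (b ^ 2 - a ^ 2)) * X + C ((a ^ 2 + b ^ 2) / (b ^ 2 - a ^ 2))), ?_, ?_⟩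
  · refine (natDegree_C_mul_le _ _).trans (natDegree_comp_le.trans ?_)
    calc _ ≤ P.natDegree * 1 := Nat.mul_le_mul_left _ natDegree_linear_le
      _ ≤ d := by simpa using hP
  · intro y hy1 hy2
    set x := (-2) / (b ^ 2 - a ^ 2) * y + (a ^ 2 + b ^ 2) / (b ^ 2 - a ^ 2) with hx
    have hx' : x = (a ^ 2 + b ^ 2 - 2 * y) / (b ^ 2 - a ^ 2) := by rw [hx]; ring
    have hx1 : -1 ≤ x := by rw [hx', le_div_iff₀ hs]; linarith
    have hx2 : x ≤ 1 := by rw [hx', div_le_iff₀ hs]; linarith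
    have hy : 0 < y := lt_of_lt_of_le (by positivity) hy1
    have hpole : (ρ + ρ⁻¹) / 2 - x = 2 / (b ^ 2 - a ^ 2) * y := by
      have : (ρ + ρ⁻¹) / 2 = (a ^ 2 + b ^ 2) / (b ^ 2 - a ^ 2) := by
        have e : b ^ 2 - a ^ 2 = (b - a) * (b + a) := by ring
        rw [hρ', e]; field_simp; ring
      rw [this, hx]; ring
    have h := hPx x hx1 hx2
    rw [hpole] at h
    have hev : (C (2 / (b ^ 2 - a ^ 2)) * P.comp (C (-2 / (b ^ 2 - a ^ 2)) * X +
        C ((a ^ 2 + b ^ 2) / (b ^ 2 - a ^ 2)))).eval y = 2 / (b ^ 2 - a ^ 2) * P.eval x := by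
      simp [eval_comp, hx]
    have hy' : y⁻¹ = 2 / (b ^ 2 - a ^ 2) * (2 / (b ^ 2 - a ^ 2) * y)⁻¹ := by field_simp
    rw [hev, hy', ← mul_sub, abs_mul, abs_of_pos (by positivity)]
    refine (mul_le_mul_of_nonneg_left h (by positivity)).trans (le_of_eq ?_)
    have e1 : 1 - ρ ^ 2 = 4 * a * b / (b + a) ^ 2 := by rw [hρ']; field_simp; ring
    have e2 : b ^ 2 - a ^ 2 = ρ * (b + a) ^ 2 := by rw [hρ']; field_simp; ring
    rw [e1, e2]
    field_simp
    ring

end Approximation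

/-! ### Off-diagonal decay of inverses of banded block matrices -/

section Decay

open Polynomial

variable {n m : ℕ}

theorem norm_one_submatrix_le {ι ι' : Type*} [Fintype ι] [Fintype ι']
    [DecidableEq ι] [DecidableEq ι'] {f : ι' → ι} (hf : Function.Injective f) :
    ‖(1 : Matrix ι ι ℂ).submatrix f id‖ ≤ 1 := by
  set R := (1 : Matrix ι ι ℂ).submatrix f id with hR
  have h1 : Rᴴᴴ * Rᴴ = Matrix.diagonal (fun _ => (1 : ℂ)) := by
    ext i j
    simp only [hR, Matrix.conjTranspose_conjTranspose, Matrix.mul_apply, Matrix.submatrix_apply,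
      Matrix.conjTranspose_apply, Matrix.one_apply, Matrix.diagonal_apply, id, hf.eq_iff,
      ite_mul, one_mul, zero_mul, Finset.sum_ite_eq, Finset.mem_univ, if_true]
    by_cases h : j = i
    · simp [h]
    · simp [h, Ne.symm h]
  have h2 : ‖R‖ * ‖R‖ ≤ 1 := by
    rw [← Matrix.l2_opNorm_conjTranspose R, ← Matrix.l2_opNorm_conjTranspose_mul_self, h1,
      Matrix.l2_opNorm_diagonal, pi_norm_le_iff_of_nonneg zero_le_one]
    simp
  nlinarith [norm_nonneg R]

/-- Selecting rows and columns is multiplication by coordinate coisometries and their adjoints. -/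
theorem norm_submatrix_le {ι κ ι' κ' : Type*} [Fintype ι] [Fintype κ] [Fintype ι'] [Fintype κ']
    [DecidableEq ι] [DecidableEq κ] [DecidableEq ι'] [DecidableEq κ']
    (X : Matrix ι κ ℂ) {f : ι' → ι} {g : κ' → κ}
    (hf : Function.Injective f) (hg : Function.Injective g) :
    ‖X.submatrix f g‖ ≤ ‖X‖ := by
  have h : X.submatrix f g =
      (1 : Matrix ι ι ℂ).submatrix f id * X * ((1 : Matrix κ κ ℂ).submatrix g id)ᴴ := by
    ext i j
    simp [Matrix.mul_apply, Matrix.one_apply, apply_ite]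
  rw [h]
  calc _ ≤ ‖(1 : Matrix ι ι ℂ).submatrix f id‖ * ‖X‖ * ‖(1 : Matrix κ κ ℂ).submatrix g id‖ := by
        refine (Matrix.l2_opNorm_mul _ _).trans ?_
        rw [Matrix.l2_opNorm_conjTranspose]
        exact mul_le_mul_of_nonneg_right (Matrix.l2_opNorm_mul _ _) (norm_nonneg _)
    _ ≤ 1 * ‖X‖ * 1 := by
        gcongr
        exacts [norm_one_submatrix_le hf, norm_one_submatrix_le hg]
    _ = ‖X‖ := by ring

/-- Block matrices whose blocks `(i, j)` vanish for `|i - j| > w`. -/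
def IsBanded (w : ℕ) (X : Matrix (Fin n × Fin m) (Fin n × Fin m) ℂ) : Prop :=
  ∀ i j : Fin n, (i : ℕ) + w < j ∨ (j : ℕ) + w < i → ∀ a b, X (i, a) (j, b) = 0

theorem IsBanded.mono {v w : ℕ} {X : Matrix (Fin n × Fin m) (Fin n × Fin m) ℂ}
    (h : IsBanded v X) (hvw : v ≤ w) : IsBanded w X :=
  fun i j hij => h i j (by omega)

theorem IsBanded.mul {v w : ℕ} {X Y : Matrix (Fin n × Fin m) (Fin n × Fin m) ℂ}
    (hX : IsBanded v X) (hY : IsBanded w Y) : IsBanded (v + w) (X * Y) := by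
  intro i j hij a b
  rw [Matrix.mul_apply]
  refine Finset.sum_eq_zero fun k _ => ?_
  by_cases h : (i : ℕ) + v < k.1 ∨ (k.1 : ℕ) + v < i
  · rw [← Prod.mk.eta (p := k), hX i k.1 h, zero_mul]
  · rw [← Prod.mk.eta (p := k), hY k.1 j (by omega), mul_zero]

theorem IsBanded.conjTranspose {w : ℕ} {X : Matrix (Fin n × Fin m) (Fin n × Fin m) ℂ}
    (h : IsBanded w X) : IsBanded w Xᴴ := by
  intro i j hij a b
  rw [Matrix.conjTranspose_apply, h j i hij.symm, star_zero]

theorem isBanded_one : IsBanded 0 (1 : Matrix (Fin n × Fin m) (Fin n × Fin m) ℂ) := by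
  intro i j hij a b
  refine Matrix.one_apply_ne fun h => ?_
  obtain rfl : i = j := congrArg Prod.fst h
  omega

theorem IsBanded.pow {w : ℕ} {X : Matrix (Fin n × Fin m) (Fin n × Fin m) ℂ}
    (h : IsBanded w X) (k : ℕ) : IsBanded (k * w) (X ^ k) := by
  induction k with
  | zero => simpa using isBanded_one
  | succ k ih => rw [pow_succ, Nat.succ_mul]; exact ih.mul h

theorem IsBanded.aeval {w d : ℕ} {X : Matrix (Fin n × Fin m) (Fin n × Fin m) ℂ}
    (h : IsBanded w X) {P : ℝ[X]} (hP : P.natDegree ≤ d) : IsBanded (d * w) (aeval X P) := by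
  intro i j hij a b
  rw [aeval_eq_sum_range, Matrix.sum_apply]
  refine Finset.sum_eq_zero fun k hk => ?_
  have hk' : k ≤ d := by rw [Finset.mem_range] at hk; omega
  rw [Matrix.smul_apply, ((h.pow k).mono (Nat.mul_le_mul_right w hk')) i j hij, smul_zero]

theorem norm_pos_of_isUnit {ι : Type*} [Fintype ι] [DecidableEq ι] [Nonempty ι]
    {M : Matrix ι ι ℂ} (hM : IsUnit M) : 0 < ‖M‖ :=
  norm_pos_iff.mpr hM.ne_zero

theorem isUnit_mul_conjTranspose {ι : Type*} [Fintype ι] [DecidableEq ι]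
    {M : Matrix ι ι ℂ} (hM : IsUnit M) : IsUnit (M * Mᴴ) :=
  hM.mul hM.star

theorem norm_mul_conjTranspose_self {ι : Type*} [Fintype ι] [DecidableEq ι] (M : Matrix ι ι ℂ) :
    ‖M * Mᴴ‖ = ‖M‖ ^ 2 := by
  have := Matrix.l2_opNorm_conjTranspose_mul_self Mᴴ
  rwa [Matrix.conjTranspose_conjTranspose, Matrix.l2_opNorm_conjTranspose, ← sq] at this

/-- The upper bound is ‖M Mᴴ‖ = ‖M‖²; the lower one is the same bound for the inverse, ‖(M Mᴴ)⁻¹‖ =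
‖M⁻¹‖². -/
theorem mem_spectrum_mul_conjTranspose {ι : Type*} [Fintype ι] [DecidableEq ι] [Nonempty ι]
    {M : Matrix ι ι ℂ} (hM : IsUnit M) {x : ℝ} (hx : x ∈ spectrum ℝ (M * Mᴴ)) :
    (1 / ‖M⁻¹‖) ^ 2 ≤ x ∧ x ≤ ‖M‖ ^ 2 := by
  have hu := isUnit_mul_conjTranspose hM
  have hnn : 0 ≤ x := by
    have := spectrum_star_mul_self_nonneg (b := star M) x
    rw [star_star] at this
    exact this hx
  have hx0 : x ≠ 0 := fun h => spectrum.zero_notMem ℝ hu (h ▸ hx)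
  have hxpos : 0 < x := lt_of_le_of_ne hnn hx0.symm
  constructor
  · have h1 : x⁻¹ ∈ spectrum ℝ (M * Mᴴ)⁻¹ := by
      have := (spectrum.inv_mem_iff (r := Units.mk0 x hx0) (a := hu.unit)).mp hx
      rwa [Matrix.coe_units_inv] at this
    have h2 : (M * Mᴴ)⁻¹ = (M⁻¹)ᴴ * M⁻¹ := by
      rw [Matrix.mul_inv_rev, Matrix.conjTranspose_nonsing_inv]
    have h3 := spectrum.norm_le_norm_of_mem h1
    rw [Real.norm_of_nonneg (inv_nonneg.mpr hnn), h2, Matrix.l2_opNorm_conjTranspose_mul_self,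
      ← sq] at h3
    rw [one_div, inv_pow]
    exact inv_le_of_inv_le₀ hxpos h3
  · have := spectrum.norm_le_norm_of_mem hx
    rwa [Real.norm_of_nonneg hnn, norm_mul_conjTranspose_self] at this

/-- By the continuous functional calculus of the self-adjoint M Mᴴ, a scalar estimate on the
spectrum is an operator norm estimate. -/
theorem norm_inv_sub_aeval_le {ι : Type*} [Fintype ι] [DecidableEq ι]
    {M : Matrix ι ι ℂ} (hM : IsUnit M) {P : ℝ[X]} {c : ℝ} (hc : 0 ≤ c)
    (h : ∀ x ∈ spectrum ℝ (M * Mᴴ), |x⁻¹ - P.eval x| ≤ c) :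
    ‖(M * Mᴴ)⁻¹ - aeval (M * Mᴴ) P‖ ≤ c := by
  have hsa : IsSelfAdjoint (M * Mᴴ) := IsSelfAdjoint.mul_star_self M
  have hu := isUnit_mul_conjTranspose hM
  have hinv : cfc (fun x : ℝ => x⁻¹) (M * Mᴴ) = (M * Mᴴ)⁻¹ := by
    have := cfc_inv_id (R := ℝ) hu.unit hsa
    rwa [Matrix.coe_units_inv] at this
  have h0 : ∀ x ∈ spectrum ℝ (M * Mᴴ), x ≠ 0 := fun x hx h0 =>
    spectrum.zero_notMem ℝ hu (h0 ▸ hx)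
  rw [← hinv, ← cfc_polynomial P (M * Mᴴ) hsa, ← cfc_sub _ _ _ (continuousOn_inv₀.mono h0)]
  exact norm_cfc_le hc h

theorem dmsC_nonneg {ι : Type*} [Fintype ι] [DecidableEq ι] (M : Matrix ι ι ℂ) : 0 ≤ dmsC M := by
  unfold dmsC; positivity

theorem dmsQ_pos {ι : Type*} [Fintype ι] [DecidableEq ι] {M : Matrix ι ι ℂ} (h : 1 < cond M) :
    0 < dmsQ M :=
  div_pos (by linarith) (by linarith)

theorem dmsQ_lt_one {ι : Type*} [Fintype ι] [DecidableEq ι] {M : Matrix ι ι ℂ} (h : 1 < cond M) :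
    dmsQ M < 1 :=
  (div_lt_one (by linarith)).mpr (by linarith)

/-- The block `(i, j)` of a block matrix. -/
def block (X : Matrix (Fin n × Fin m) (Fin n × Fin m) ℂ) (i j : Fin n) :
    Matrix (Fin m) (Fin m) ℂ :=
  X.submatrix (Prod.mk i) (Prod.mk j)

theorem block_mul (X Y : Matrix (Fin n × Fin m) (Fin n × Fin m) ℂ) (i j : Fin n) :
    block (X * Y) i j = ∑ k, block X i k * block Y k j := by
  ext a b
  simp [block, Matrix.mul_apply, Matrix.sum_apply, Fintype.sum_prod_type]

theorem block_conjTranspose (X : Matrix (Fin n × Fin m) (Fin n × Fin m) ℂ) (i j : Fin n) :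
    block Xᴴ i j = (block X j i)ᴴ :=
  rfl

theorem norm_block_le (X : Matrix (Fin n × Fin m) (Fin n × Fin m) ℂ) (i j : Fin n) :
    ‖block X i j‖ ≤ ‖X‖ :=
  norm_submatrix_le X (Prod.mk_right_injective i) (Prod.mk_right_injective j)

theorem cond_eq_div {ι : Type*} [Fintype ι] [DecidableEq ι] (M : Matrix ι ι ℂ) :
    cond M = ‖M‖ / (1 / ‖M⁻¹‖) := by
  rw [cond, div_div_eq_mul_div, div_one]

/-- The theorem of Demko, Moss and Smith for `M Mᴴ`. -/
theorem norm_block_inv_mul_conjTranspose_le {M : Matrix (Fin n × Fin m) (Fin n × Fin m) ℂ}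
    (hM : IsUnit M) (hb : IsBanded 1 M) (hc : 1 < cond M) {i j : Fin n} {d : ℕ}
    (hij : (i : ℕ) + d * 2 < j ∨ (j : ℕ) + d * 2 < i) :
    ‖block (M * Mᴴ)⁻¹ i j‖ ≤ dmsC M * dmsQ M ^ (d + 1) := by
  by_cases hm : m = 0
  · subst hm
    rw [Subsingleton.elim (block (M * Mᴴ)⁻¹ i j) 0, norm_zero]
    exact mul_nonneg (dmsC_nonneg M) (pow_nonneg (dmsQ_pos hc).le _)
  have : Nonempty (Fin n × Fin m) := ⟨(i, ⟨0, Nat.pos_of_ne_zero hm⟩)⟩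
  have h1 : 0 < ‖M‖ := norm_pos_of_isUnit hM
  have h2 : 0 < ‖M⁻¹‖ := norm_pos_of_isUnit (Matrix.isUnit_nonsing_inv_iff.mpr hM)
  have h3 : 1 / ‖M⁻¹‖ < ‖M‖ := by rwa [div_lt_iff₀ h2]
  obtain ⟨P, hPd, hP⟩ := exists_polynomial_approx_inv (by positivity) h3 d
  rw [← cond_eq_div] at hP
  have hle := norm_inv_sub_aeval_le hM (P := P)
    (mul_nonneg (dmsC_nonneg M) (pow_nonneg (dmsQ_pos hc).le (d + 1)))
    fun x hx => hP x (mem_spectrum_mul_conjTranspose hM hx).1 (mem_spectrum_mul_conjTranspose hM hx).2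
  have hband : IsBanded (d * 2) (aeval (M * Mᴴ) P) := (hb.mul hb.conjTranspose).aeval hPd
  -- The polynomial vanishes on this block, so only the approximation error remains.
  have hblock : block (M * Mᴴ)⁻¹ i j = block ((M * Mᴴ)⁻¹ - aeval (M * Mᴴ) P) i j := by
    ext a b
    simp [block, hband i j hij a b]
  rw [hblock]
  exact (norm_block_le _ i j).trans hle

theorem norm_block_inv_mul_conjTranspose_le_rpow
    {M : Matrix (Fin n × Fin m) (Fin n × Fin m) ℂ}
    (hM : IsUnit M) (hb : IsBanded 1 M) (hc : 1 < cond M) {i j : Fin n} {s : ℕ} (hs : 1 ≤ s)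
    (hij : (i : ℕ) + s ≤ j ∨ (j : ℕ) + s ≤ i) :
    ‖block (M * Mᴴ)⁻¹ i j‖ ≤ dmsC M * dmsQ M ^ ((s : ℝ) / 2) := by
  -- This is the largest d with 2d < s, and d + 1 ≥ s/2.
  refine (norm_block_inv_mul_conjTranspose_le hM hb hc (d := (s - 1) / 2) (by omega)).trans ?_
  refine mul_le_mul_of_nonneg_left ?_ (dmsC_nonneg M)
  rw [← Real.rpow_natCast]
  refine Real.rpow_le_rpow_of_exponent_ge (dmsQ_pos hc) (dmsQ_lt_one hc).le ?_
  have : s ≤ 2 * ((s - 1) / 2 + 1) := by omega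
  have : (s : ℝ) ≤ 2 * (((s - 1) / 2 + 1 : ℕ) : ℝ) := by exact_mod_cast this
  linarith

/-- In M⁻¹ = Mᴴ (M Mᴴ)⁻¹ block row i of Mᴴ has at most two nonzero blocks, because block column i of
M does; this is the case of a corner of the chain. -/
theorem norm_block_inv_le {M : Matrix (Fin n × Fin m) (Fin n × Fin m) ℂ}
    (hM : IsUnit M) (hb : IsBanded 1 M) (hc : 1 < cond M) {i i' j : Fin n} (hii' : i ≠ i')
    (hi : ∀ k, k ≠ i → k ≠ i' → block M k i = 0) {s : ℕ} (hs : 1 ≤ s)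
    (hij : (i : ℕ) + s ≤ j ∨ (j : ℕ) + s ≤ i) (hij' : (i' : ℕ) + s ≤ j ∨ (j : ℕ) + s ≤ i') :
    ‖block M⁻¹ i j‖ ≤
      (‖block M i i‖ + ‖block M i' i‖) * (dmsC M * dmsQ M ^ ((s : ℝ) / 2)) := by
  have hinv : M⁻¹ = Mᴴ * (M * Mᴴ)⁻¹ := by
    have hdet : IsUnit Mᴴ.det := (Matrix.isUnit_iff_isUnit_det _).mp hM.star
    rw [Matrix.mul_inv_rev, ← mul_assoc, Matrix.mul_nonsing_inv _ hdet, one_mul]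
  have hsum : block M⁻¹ i j = (block M i i)ᴴ * block (M * Mᴴ)⁻¹ i j +
      (block M i' i)ᴴ * block (M * Mᴴ)⁻¹ i' j := by
    rw [hinv, block_mul, ← block_conjTranspose, ← block_conjTranspose,
      ← Finset.sum_pair hii' (f := fun k => block Mᴴ i k * block (M * Mᴴ)⁻¹ k j)]
    symm
    refine Finset.sum_subset (Finset.subset_univ _) fun k _ hk => ?_
    simp only [Finset.mem_insert, Finset.mem_singleton, not_or] at hk
    rw [block_conjTranspose, hi k hk.1 hk.2, Matrix.conjTranspose_zero, zero_mul]
  rw [hsum, add_mul]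
  refine (norm_add_le _ _).trans (add_le_add ?_ ?_)
  all_goals
    refine (Matrix.l2_opNorm_mul _ _).trans ?_
    rw [Matrix.l2_opNorm_conjTranspose]
    exact mul_le_mul_of_nonneg_left
      (norm_block_inv_mul_conjTranspose_le_rpow hM hb hc hs ‹_›) (norm_nonneg _)

/-- A matrix whose condition number is at most one is a multiple of a unitary matrix. -/
theorem mul_conjTranspose_eq_smul_one_of_cond_le_one {ι : Type*} [Fintype ι] [DecidableEq ι]
    [Nonempty ι] {M : Matrix ι ι ℂ} (hM : IsUnit M) (hc : cond M ≤ 1) :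
    M * Mᴴ = (‖M‖ ^ 2) • (1 : Matrix ι ι ℂ) := by
  have h1 : 0 < ‖M‖ := norm_pos_of_isUnit hM
  have h2 : 0 < ‖M⁻¹‖ := norm_pos_of_isUnit (Matrix.isUnit_nonsing_inv_iff.mpr hM)
  have h3 : ‖M‖ ≤ 1 / ‖M⁻¹‖ := by rwa [le_div_iff₀ h2]
  -- The spectrum is the single point ‖M‖², where a constant polynomial represents 1/y exactly.
  have hle := norm_inv_sub_aeval_le hM (P := C (‖M‖ ^ 2)⁻¹) le_rfl fun x hx => by
    obtain ⟨hx1, hx2⟩ := mem_spectrum_mul_conjTranspose hM hx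
    have : x = ‖M‖ ^ 2 := le_antisymm hx2 ((pow_le_pow_left₀ h1.le h3 2).trans hx1)
    simp [this]
  have h := sub_eq_zero.mp (norm_le_zero_iff.mp hle)
  rw [aeval_C, Algebra.algebraMap_eq_smul_one] at h
  have hdet := (Matrix.isUnit_iff_isUnit_det _).mp (isUnit_mul_conjTranspose hM)
  have h4 := Matrix.mul_nonsing_inv _ hdet
  rw [h, Matrix.mul_smul, mul_one] at h4
  rw [← h4, smul_smul, mul_inv_cancel₀ (by positivity), one_smul]

end Decay

/-! ### The matrix h - E: bandwidth, invertibility, condition number -/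

section Chain

variable {n m : ℕ} {A B C : ℕ → Matrix (Fin m) (Fin m) ℂ} {E : ℂ}

theorem block_shifted (i j : Fin n) :
    block (shifted n A B C E) i j =
      if j = i then A (i + 1) - Matrix.scalar (Fin m) E
      else if (j : ℕ) = i + 1 then B (i + 1)
      else if (i : ℕ) = j + 1 then C (i + 1)
      else 0 := by
  ext a b
  simp only [block, shifted, openChain, Matrix.submatrix_apply, Matrix.sub_apply, Matrix.of_apply,
    Matrix.scalar_apply, Matrix.diagonal_apply, Prod.mk.injEq]
  by_cases h : j = i
  · simp [h, Matrix.diagonal_apply]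
  · simp only [h, Ne.symm h, if_false, false_and, sub_zero]
    split_ifs <;> rfl

theorem isBanded_shifted : IsBanded 1 (shifted n A B C E) := by
  intro i j hij a b
  have h := congrFun (congrFun (block_shifted (A := A) (B := B) (C := C) (E := E) i j) a) b
  rw [if_neg (by rintro rfl; omega), if_neg (by omega), if_neg (by omega)] at h
  exact h

theorem isUnit_shifted (hE : E ∉ spectrum ℂ (openChain n A B C)) :
    IsUnit (shifted n A B C E) := by
  rw [spectrum.notMem_iff] at hE
  have := hE.neg
  rwa [neg_sub] at this

/-- Otherwise M Mᴴ would be scalar, but its block (1, 3) is B_1 C_3ᴴ, which is invertible. Existence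
of a third site is essential here. Strictness gives q > 0 and a nondegenerate interval for the
approximation. -/
theorem one_lt_cond_shifted (hm : 0 < m) (hn : 3 ≤ n)
    (hB : ∀ k ∈ Finset.Icc 1 n, IsUnit (B k)) (hC : ∀ k ∈ Finset.Icc 1 n, IsUnit (C k))
    (hE : E ∉ spectrum ℂ (openChain n A B C)) : 1 < cond (shifted n A B C E) := by
  by_contra! hc
  have : Nonempty (Fin m) := ⟨⟨0, hm⟩⟩
  set i : Fin n := ⟨0, by omega⟩
  set j : Fin n := ⟨1, by omega⟩
  set l : Fin n := ⟨2, by omega⟩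
  have : Nonempty (Fin n) := ⟨i⟩
  have h := mul_conjTranspose_eq_smul_one_of_cond_le_one (isUnit_shifted hE) hc
  have h0 : block (shifted n A B C E * (shifted n A B C E)ᴴ) i l = 0 := by
    rw [h]
    ext a b
    simp [block, i, l]
  rw [block_mul, Finset.sum_eq_single j] at h0
  · have hu : IsUnit (B 1 * (C 3)ᴴ) := (hB 1 (by simp; omega)).mul (hC 3 (by simp; omega)).star
    apply hu.ne_zero
    simpa [block_conjTranspose, block_shifted, i, j, l] using h0
  · intro k _ hk
    rw [block_conjTranspose, block_shifted, block_shifted]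
    by_cases hki : k = i
    · subst hki
      simp [i, l]
    · have h1 : (k : ℕ) ≠ 1 := fun h => hk (Fin.ext h)
      rw [if_neg hki, if_neg (by simpa [i] using h1), if_neg (by simp [i]), zero_mul]
  · simp

end Chain

/-! ### Counting singular values by dimension -/

section SingularValues

variable {V W : Type*} [NormedAddCommGroup V] [InnerProductSpace ℂ V] [FiniteDimensional ℂ V]
  [NormedAddCommGroup W] [InnerProductSpace ℂ W] [FiniteDimensional ℂ W]

theorem norm_sq_apply_eq_sum_singularValues (T : V →ₗ[ℂ] W) {N : ℕ}
    (hN : Module.finrank ℂ V = N) (v : V) :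
    ‖T v‖ ^ 2 = ∑ i : Fin N, T.singularValues i ^ 2 *
      ‖(T.isSymmetric_adjoint_comp_self.eigenvectorBasis hN).repr v i‖ ^ 2 := by
  set b := T.isSymmetric_adjoint_comp_self.eigenvectorBasis hN
  have h1 : ‖T v‖ ^ 2 = RCLike.re (inner ℂ v ((LinearMap.adjoint T ∘ₗ T) v)) := by
    rw [LinearMap.comp_apply, LinearMap.adjoint_inner_right, inner_self_eq_norm_sq]
  rw [h1, ← b.repr.inner_map_map, PiLp.inner_apply, map_sum]
  refine Finset.sum_congr rfl fun i _ => ?_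
  rw [LinearMap.IsSymmetric.eigenvectorBasis_apply_self_apply, T.sq_singularValues_fin hN]
  rw [← smul_eq_mul, inner_smul_right, inner_self_eq_norm_sq_to_K]
  norm_cast

/-- If `T` expands every nonzero vector of an `m`-dimensional space by a factor larger than `x`,
then at least `m` singular values are larger than `x`. -/
theorem le_card_lt_singularValues (T : V →ₗ[ℂ] W) {N m : ℕ} (hN : Module.finrank ℂ V = N)
    (L : (Fin m → ℂ) →ₗ[ℂ] V) {x : ℝ} (hx : 0 ≤ x)
    (h : ∀ w ≠ 0, x * ‖L w‖ < ‖T (L w)‖) :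
    m ≤ (Finset.univ.filter fun i : Fin N => x < T.singularValues i).card := by
  set b := T.isSymmetric_adjoint_comp_self.eigenvectorBasis hN with hb
  -- `R` takes the coordinates of L w along the right singular vectors with singular value above x.
  -- If they all vanish, T stretches L w by at most x, against `h`; so `R` is injective.
  let R : (Fin m → ℂ) →ₗ[ℂ] ({i : Fin N // x < T.singularValues i} → ℂ) :=
    LinearMap.pi fun i =>
      (EuclideanSpace.proj i.1).toLinearMap ∘ₗ b.repr.toLinearEquiv.toLinearMap ∘ₗ L
  have hR : Function.Injective R := by
    rw [injective_iff_map_eq_zero]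
    intro w hw
    by_contra hne
    have hzero : ∀ i : Fin N, x < T.singularValues i → b.repr (L w) i = 0 := fun i hi =>
      congrFun hw ⟨i, hi⟩
    have hle : ‖T (L w)‖ ^ 2 ≤ (x * ‖L w‖) ^ 2 := by
      rw [norm_sq_apply_eq_sum_singularValues T hN, ← hb, mul_pow, ← b.repr.norm_map,
        EuclideanSpace.norm_sq_eq, Finset.mul_sum]
      refine Finset.sum_le_sum fun i _ => ?_
      by_cases hi : x < T.singularValues i
      · simp [hzero i hi]
      · exact mul_le_mul_of_nonneg_right
          (pow_le_pow_left₀ (T.singularValues_nonneg i) (not_lt.mp hi) 2) (by positivity)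
    exact absurd (h w hne) (not_lt.mpr (le_of_sq_le_sq hle (by positivity)))
  simpa [Fintype.card_subtype] using LinearMap.finrank_le_finrank_of_injective hR

/-- If `T` contracts every nonzero vector of an `m`-dimensional space by a factor smaller than `x`,
then at least `m` singular values are smaller than `x`. -/
theorem le_card_singularValues_lt (T : V →ₗ[ℂ] W) {N m : ℕ} (hN : Module.finrank ℂ V = N)
    (L : (Fin m → ℂ) →ₗ[ℂ] V) {x : ℝ} (hx : 0 ≤ x)
    (h : ∀ w ≠ 0, ‖T (L w)‖ < x * ‖L w‖) :
    m ≤ (Finset.univ.filter fun i : Fin N => T.singularValues i < x).card := by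
  set b := T.isSymmetric_adjoint_comp_self.eigenvectorBasis hN with hb
  let R : (Fin m → ℂ) →ₗ[ℂ] ({i : Fin N // T.singularValues i < x} → ℂ) :=
    LinearMap.pi fun i =>
      (EuclideanSpace.proj i.1).toLinearMap ∘ₗ b.repr.toLinearEquiv.toLinearMap ∘ₗ L
  have hR : Function.Injective R := by
    rw [injective_iff_map_eq_zero]
    intro w hw
    by_contra hne
    have hzero : ∀ i : Fin N, T.singularValues i < x → b.repr (L w) i = 0 := fun i hi =>
      congrFun hw ⟨i, hi⟩
    have hle : (x * ‖L w‖) ^ 2 ≤ ‖T (L w)‖ ^ 2 := by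
      rw [norm_sq_apply_eq_sum_singularValues T hN, ← hb, mul_pow, ← b.repr.norm_map,
        EuclideanSpace.norm_sq_eq, Finset.mul_sum]
      refine Finset.sum_le_sum fun i _ => ?_
      by_cases hi : T.singularValues i < x
      · simp [hzero i hi]
      · exact mul_le_mul_of_nonneg_right
          (pow_le_pow_left₀ hx (not_lt.mp hi) 2) (by positivity)
    exact absurd (h w hne) (not_lt.mpr (le_of_sq_le_sq hle (by positivity)))
  simpa [Fintype.card_subtype] using LinearMap.finrank_le_finrank_of_injective hR

theorem card_filter_range_eq (N : ℕ) (p : ℕ → Prop) [DecidablePred p] :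
    ((Finset.range N).filter p).card = (Finset.univ.filter fun i : Fin N => p i).card := by
  rw [Finset.card_filter, Finset.card_filter, Finset.sum_range]

variable {ι : Type*} [Fintype ι] [DecidableEq ι]

theorem le_numGT (M : Matrix ι ι ℂ) {m : ℕ} (L : (Fin m → ℂ) →ₗ[ℂ] ι → ℂ)
    {x : ℝ} (hx : 0 ≤ x)
    (h : ∀ w ≠ 0, x * ‖WithLp.toLp 2 (L w)‖ < ‖WithLp.toLp 2 (M *ᵥ L w)‖) : m ≤ numGT M x := by
  rw [numGT, card_filter_range_eq]
  exact le_card_lt_singularValues (Matrix.toEuclideanLin M) finrank_euclideanSpace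
    ((WithLp.linearEquiv 2 ℂ (ι → ℂ)).symm.toLinearMap ∘ₗ L) hx h

theorem le_numLT (M : Matrix ι ι ℂ) {m : ℕ} (L : (Fin m → ℂ) →ₗ[ℂ] ι → ℂ)
    {x : ℝ} (hx : 0 ≤ x)
    (h : ∀ w ≠ 0, ‖WithLp.toLp 2 (M *ᵥ L w)‖ < x * ‖WithLp.toLp 2 (L w)‖) : m ≤ numLT M x := by
  rw [numLT, card_filter_range_eq]
  exact le_card_singularValues_lt (Matrix.toEuclideanLin M) finrank_euclideanSpace
    ((WithLp.linearEquiv 2 ℂ (ι → ℂ)).symm.toLinearMap ∘ₗ L) hx h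

theorem numGT_add_numLT_le (M : Matrix ι ι ℂ) {x y : ℝ} (h : y ≤ x) :
    numGT M x + numLT M y ≤ Fintype.card ι := by
  rw [numGT, numLT, ← Finset.card_union_of_disjoint]
  · refine (Finset.card_le_card (Finset.union_subset (Finset.filter_subset _ _)
      (Finset.filter_subset _ _))).trans (Finset.card_range _).le
  · exact Finset.disjoint_filter.mpr fun i _ h1 h2 => absurd (h1.trans h2) (not_lt.mpr h)

theorem numGT_anti (M : Matrix ι ι ℂ) {x y : ℝ} (h : x ≤ y) : numGT M y ≤ numGT M x :=
  Finset.card_le_card (Finset.monotone_filter_right _ fun _ _ hi => h.trans_lt hi)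

theorem numLT_mono (M : Matrix ι ι ℂ) {x y : ℝ} (h : x ≤ y) : numLT M x ≤ numLT M y :=
  Finset.card_le_card (Finset.monotone_filter_right _ fun _ _ hi => lt_of_lt_of_le hi h)

/-- For y ≤ x the two counts concern disjoint sets among 2m singular values, so two lower bounds m
force equality. -/
theorem numGT_eq_and_numLT_eq {m : ℕ} {M : Matrix (Fin m ⊕ Fin m) (Fin m ⊕ Fin m) ℂ} {x y : ℝ}
    (h : y ≤ x) (h1 : m ≤ numGT M x) (h2 : m ≤ numLT M y) : numGT M x = m ∧ numLT M y = m := by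
  have := numGT_add_numLT_le M h
  simp only [Fintype.card_sum, Fintype.card_fin] at this
  omega

end SingularValues

/-! ### Solutions of the recursion in terms of the resolvent -/

section Dynamics

variable {n m : ℕ} {A B C : ℕ → Matrix (Fin m) (Fin m) ℂ} {E : ℂ}

theorem isUnit_step {k : ℕ} (hB : IsUnit (B k)) (hC : IsUnit (C k)) :
    IsUnit (step A B C E k) := by
  have hB' := (Matrix.isUnit_iff_isUnit_det _).mp hB
  have hC' := (Matrix.isUnit_iff_isUnit_det _).mp hC
  refine IsUnit.of_mul_eq_one (Matrix.fromBlocks 0 1 (-((C k)⁻¹ * B k))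
    ((C k)⁻¹ * (Matrix.scalar (Fin m) E - A k))) ?_
  rw [step, Matrix.fromBlocks_multiply, ← Matrix.fromBlocks_one]
  congr 1
  · rw [mul_zero, zero_add, neg_mul_neg, mul_assoc, Matrix.mul_nonsing_inv_cancel_left _ _ hC',
      Matrix.nonsing_inv_mul _ hB']
  · rw [mul_one, neg_mul, mul_assoc, Matrix.mul_nonsing_inv_cancel_left _ _ hC', add_neg_cancel]
  · simp
  · simp

theorem isUnit_transfer (hB : ∀ k ∈ Finset.Icc 1 n, IsUnit (B k))
    (hC : ∀ k ∈ Finset.Icc 1 n, IsUnit (C k)) : IsUnit (transfer A B C E n) := by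
  induction n with
  | zero => exact isUnit_one
  | succ k ih =>
    have hk : k + 1 ∈ Finset.Icc 1 (k + 1) := by simp
    have hsub : Finset.Icc 1 k ⊆ Finset.Icc 1 (k + 1) := Finset.Icc_subset_Icc_right k.le_succ
    exact (isUnit_step (hB _ hk) (hC _ hk)).mul
      (ih (fun j hj => hB j (hsub hj)) fun j hj => hC j (hsub hj))

/-- The solution `u k` of the recursion whose initial data `(u 1, u 0)` are `v`. -/
noncomputable def solution (A B C : ℕ → Matrix (Fin m) (Fin m) ℂ) (E : ℂ)
    (v : Fin m ⊕ Fin m → ℂ) (k : ℕ) : Fin m → ℂ :=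
  (transfer A B C E k *ᵥ v) ∘ Sum.inr

theorem transfer_succ_mulVec (v : Fin m ⊕ Fin m → ℂ) (k : ℕ) :
    transfer A B C E (k + 1) *ᵥ v = Sum.elim
      ((B (k + 1))⁻¹ *ᵥ ((Matrix.scalar (Fin m) E - A (k + 1)) *ᵥ
        ((transfer A B C E k *ᵥ v) ∘ Sum.inl) - C (k + 1) *ᵥ solution A B C E v k))
      ((transfer A B C E k *ᵥ v) ∘ Sum.inl) := by
  rw [transfer, ← Matrix.mulVec_mulVec, step, Matrix.fromBlocks_mulVec]
  congr 1
  · rw [Matrix.mulVec_sub, Matrix.mulVec_mulVec, Matrix.mulVec_mulVec, Matrix.neg_mulVec,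
      sub_eq_add_neg]
    rfl
  · simp

theorem solution_succ (v : Fin m ⊕ Fin m → ℂ) (k : ℕ) :
    solution A B C E v (k + 1) = (transfer A B C E k *ᵥ v) ∘ Sum.inl := by
  rw [solution, transfer_succ_mulVec, Sum.elim_comp_inr]

theorem solution_zero (v : Fin m ⊕ Fin m → ℂ) : solution A B C E v 0 = v ∘ Sum.inr := by
  rw [solution, transfer, Matrix.one_mulVec]

theorem transfer_mulVec (v : Fin m ⊕ Fin m → ℂ) (k : ℕ) :
    transfer A B C E k *ᵥ v =
      Sum.elim (solution A B C E v (k + 1)) (solution A B C E v k) := by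
  rw [solution_succ, solution, Sum.elim_comp_inl_inr]

theorem solution_recursion (v : Fin m ⊕ Fin m → ℂ) {k : ℕ} (hB : IsUnit (B (k + 1))) :
    C (k + 1) *ᵥ solution A B C E v k
      + (A (k + 1) - Matrix.scalar (Fin m) E) *ᵥ solution A B C E v (k + 1)
      + B (k + 1) *ᵥ solution A B C E v (k + 2) = 0 := by
  have hB' := (Matrix.isUnit_iff_isUnit_det _).mp hB
  rw [solution_succ v (k + 1), transfer_succ_mulVec, Sum.elim_comp_inl, Matrix.mulVec_mulVec,
    Matrix.mul_nonsing_inv _ hB', Matrix.one_mulVec, ← solution_succ, Matrix.sub_mulVec,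
    Matrix.sub_mulVec]
  abel

theorem mulVec_block (X : Matrix (Fin n × Fin m) (Fin n × Fin m) ℂ) (U : Fin n → Fin m → ℂ)
    (i : Fin n) :
    (fun a => (X *ᵥ fun p => U p.1 p.2) (i, a)) = ∑ j, block X i j *ᵥ U j := by
  ext a
  simp [Matrix.mulVec, dotProduct, Fintype.sum_prod_type, block]

/-- The open chain omits C_1 and B_n, so the recursion at the two end sites leaves exactly these
boundary terms. -/
theorem shifted_mulVec_solution (hB : ∀ k ∈ Finset.Icc 1 n, IsUnit (B k))
    (v : Fin m ⊕ Fin m → ℂ) :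
    (shifted n A B C E *ᵥ fun p => solution A B C E v (p.1 + 1) p.2) =
      fun p => ((if (p.1 : ℕ) = 0 then -(C 1 *ᵥ solution A B C E v 0) else 0) +
        (if (p.1 : ℕ) + 1 = n then -(B n *ᵥ solution A B C E v (n + 1)) else 0)) p.2 := by
  set u := solution A B C E v
  ext ⟨i, a⟩
  have h := congrFun (mulVec_block (shifted n A B C E) (fun i => u (i + 1)) i) a
  refine h.trans (congrFun ?_ a)
  have hsplit : ∀ j : Fin n, block (shifted n A B C E) i j *ᵥ u (j + 1) =
      (if j = i then (A (i + 1) - Matrix.scalar (Fin m) E) *ᵥ u (i + 1) else 0) +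
      (if (j : ℕ) = i + 1 then B (i + 1) *ᵥ u (i + 2) else 0) +
      (if (i : ℕ) = j + 1 then C (i + 1) *ᵥ u i else 0) := by
    intro j
    rw [block_shifted]
    by_cases h1 : j = i
    · subst h1; simp
    · by_cases h2 : (j : ℕ) = i + 1
      · rw [if_neg h1, if_pos h2, if_neg h1, if_pos h2, if_neg (by omega), h2]; simp
      · by_cases h3 : (i : ℕ) = j + 1
        · rw [if_neg h1, if_neg h2, if_pos h3, if_neg h1, if_neg h2, if_pos h3, ← h3]; simp
        · simp [h1, h2, h3]
  have hup : ∑ j : Fin n, (if (j : ℕ) = i + 1 then B (i + 1) *ᵥ u (i + 2) else 0) =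
      if (i : ℕ) + 1 = n then 0 else B (i + 1) *ᵥ u (i + 2) := by
    split_ifs with hi
    · exact Finset.sum_eq_zero fun j _ => if_neg (by omega)
    · rw [Finset.sum_eq_single ⟨i + 1, by omega⟩]
      · simp
      · exact fun j _ hj => if_neg fun h => hj (Fin.ext h)
      · simp
  have hlow : ∑ j : Fin n, (if (i : ℕ) = j + 1 then C (i + 1) *ᵥ u i else 0) =
      if (i : ℕ) = 0 then 0 else C (i + 1) *ᵥ u i := by
    split_ifs with hi
    · exact Finset.sum_eq_zero fun j _ => if_neg (by omega)
    · rw [Finset.sum_eq_single ⟨i - 1, by omega⟩]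
      · exact if_pos (by simp only; omega)
      · exact fun j _ hj => if_neg fun h => hj (Fin.ext (by simp only; omega))
      · simp
  rw [Finset.sum_congr rfl fun j _ => hsplit j, Finset.sum_add_distrib, Finset.sum_add_distrib,
    Finset.sum_ite_eq' , if_pos (Finset.mem_univ i), hup, hlow]
  have hrec := solution_recursion (A := A) (C := C) (E := E) v
    (hB (i + 1) (Finset.mem_Icc.mpr ⟨by omega, i.2⟩))
  have e0 : (i : ℕ) = 0 → C (i + 1) *ᵥ u i = C 1 *ᵥ u 0 := fun h => by rw [h]
  have en : (i : ℕ) + 1 = n → B (i + 1) *ᵥ u (i + 2) = B n *ᵥ u (n + 1) := fun h =>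
    congrArg (fun k => B k *ᵥ u (k + 1)) h
  change C (i + 1) *ᵥ u i + _ *ᵥ u (i + 1) + B (i + 1) *ᵥ u (i + 2) = 0 at hrec
  have hmid : (A (i + 1) - Matrix.scalar (Fin m) E) *ᵥ u (i + 1) =
      -(C (i + 1) *ᵥ u i) - B (i + 1) *ᵥ u (i + 2) := by
    rw [← sub_eq_zero, ← hrec]; abel
  rw [hmid]
  split_ifs with h1 h2 h2
  · rw [← e0 h2, ← en h1]; abel
  · rw [← en h1]; abel
  · rw [← e0 h2]; abel
  · abel

theorem solution_eq_inv_mulVec (hB : ∀ k ∈ Finset.Icc 1 n, IsUnit (B k))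
    (hE : E ∉ spectrum ℂ (openChain n A B C)) (v : Fin m ⊕ Fin m → ℂ) (i : Fin n) :
    solution A B C E v (i + 1) = ∑ j : Fin n, block (shifted n A B C E)⁻¹ i j *ᵥ
      ((if (j : ℕ) = 0 then -(C 1 *ᵥ solution A B C E v 0) else 0) +
        (if (j : ℕ) + 1 = n then -(B n *ᵥ solution A B C E v (n + 1)) else 0)) := by
  rw [← mulVec_block (shifted n A B C E)⁻¹ (fun j : Fin n =>
      (if (j : ℕ) = 0 then -(C 1 *ᵥ solution A B C E v 0) else 0) +
        (if (j : ℕ) + 1 = n then -(B n *ᵥ solution A B C E v (n + 1)) else 0)) i,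
    ← shifted_mulVec_solution hB v, Matrix.mulVec_mulVec,
    Matrix.nonsing_inv_mul _ ((Matrix.isUnit_iff_isUnit_det _).mp (isUnit_shifted hE)),
    Matrix.one_mulVec]

/-- Only the source at the right end survives, so the solution is governed by the last block column
of the resolvent. -/
theorem solution_eq_of_solution_zero_eq_zero {l : Fin n} (hl : (l : ℕ) + 1 = n) {i : Fin n}
    (hB : ∀ k ∈ Finset.Icc 1 n, IsUnit (B k)) (hE : E ∉ spectrum ℂ (openChain n A B C))
    {v : Fin m ⊕ Fin m → ℂ} (hv : solution A B C E v 0 = 0) :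
    solution A B C E v (i + 1) =
      -((block (shifted n A B C E)⁻¹ i l * B n) *ᵥ solution A B C E v (n + 1)) := by
  rw [solution_eq_inv_mulVec hB hE, Finset.sum_eq_single l]
  · simp [hv, hl, Matrix.mulVec_neg]
  · intro j _ hj
    have : ¬ (j : ℕ) + 1 = n := fun h => hj (Fin.ext (by omega))
    simp [hv, this]
  · simp

theorem solution_eq_of_solution_succ_eq_zero {l : Fin n} (hl : (l : ℕ) = 0) {i : Fin n}
    (hB : ∀ k ∈ Finset.Icc 1 n, IsUnit (B k)) (hE : E ∉ spectrum ℂ (openChain n A B C))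
    {v : Fin m ⊕ Fin m → ℂ} (hv : solution A B C E v (n + 1) = 0) :
    solution A B C E v (i + 1) =
      -((block (shifted n A B C E)⁻¹ i l * C 1) *ᵥ solution A B C E v 0) := by
  rw [solution_eq_inv_mulVec hB hE, Finset.sum_eq_single l]
  · simp [hv, hl, Matrix.mulVec_neg]
  · intro j _ hj
    have : ¬ (j : ℕ) = 0 := fun h => hj (Fin.ext (by omega))
    simp [hv, this]
  · simp

end Dynamics

/-! ### Corner blocks of the resolvent and the final counts -/

section Bounds

variable {n m : ℕ} {A B C : ℕ → Matrix (Fin m) (Fin m) ℂ} {E : ℂ}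

theorem norm_toLp_mulVec_le {ι κ : Type*} [Fintype ι] [Fintype κ] [DecidableEq κ]
    (X : Matrix ι κ ℂ) (w : κ → ℂ) :
    ‖WithLp.toLp 2 (X *ᵥ w)‖ ≤ ‖X‖ * ‖WithLp.toLp 2 w‖ :=
  X.l2_opNorm_mulVec (WithLp.toLp 2 w)

theorem norm_toLp_sumElim_sq {ι κ : Type*} [Fintype ι] [Fintype κ] (a : ι → ℂ) (b : κ → ℂ) :
    ‖WithLp.toLp 2 (Sum.elim a b)‖ ^ 2 = ‖WithLp.toLp 2 a‖ ^ 2 + ‖WithLp.toLp 2 b‖ ^ 2 := by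
  simp [EuclideanSpace.norm_sq_eq]

theorem norm_toLp_le_sumElim_left {ι κ : Type*} [Fintype ι] [Fintype κ] (a : ι → ℂ) (b : κ → ℂ) :
    ‖WithLp.toLp 2 a‖ ≤ ‖WithLp.toLp 2 (Sum.elim a b)‖ := by
  refine le_of_sq_le_sq ?_ (norm_nonneg _)
  rw [norm_toLp_sumElim_sq]
  exact le_add_of_nonneg_right (sq_nonneg _)

theorem norm_toLp_le_sumElim_right {ι κ : Type*} [Fintype ι] [Fintype κ] (a : ι → ℂ)
    (b : κ → ℂ) : ‖WithLp.toLp 2 b‖ ≤ ‖WithLp.toLp 2 (Sum.elim a b)‖ := by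
  refine le_of_sq_le_sq ?_ (norm_nonneg _)
  rw [norm_toLp_sumElim_sq]
  exact le_add_of_nonneg_left (sq_nonneg _)

theorem norm_toLp_sumElim_zero_right {ι κ : Type*} [Fintype ι] [Fintype κ] (a : ι → ℂ) :
    ‖WithLp.toLp 2 (Sum.elim a (0 : κ → ℂ))‖ = ‖WithLp.toLp 2 a‖ := by
  rw [← sq_eq_sq₀ (norm_nonneg _) (norm_nonneg _), norm_toLp_sumElim_sq]
  simp

theorem norm_toLp_sumElim_zero_left {ι κ : Type*} [Fintype ι] [Fintype κ] (b : κ → ℂ) :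
    ‖WithLp.toLp 2 (Sum.elim (0 : ι → ℂ) b)‖ = ‖WithLp.toLp 2 b‖ := by
  rw [← sq_eq_sq₀ (norm_nonneg _) (norm_nonneg _), norm_toLp_sumElim_sq]
  simp

theorem norm_toLp_pos {ι : Type*} [Fintype ι] {w : ι → ℂ} (hw : w ≠ 0) :
    0 < ‖WithLp.toLp 2 w‖ :=
  norm_pos_iff.mpr fun h => hw (congrArg WithLp.ofLp h)

/-- Large singular values from a bound on the corner block of the resolvent. -/
theorem le_numGT_transfer (hB : ∀ k ∈ Finset.Icc 1 n, IsUnit (B k))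
    (hE : E ∉ spectrum ℂ (openChain n A B C)) {i l : Fin n} (hi : (i : ℕ) = 0)
    (hl : (l : ℕ) + 1 = n) {κ : ℝ}
    (hκ : ‖block (shifted n A B C E)⁻¹ i l‖ * ‖B n‖ < κ) :
    m ≤ numGT (transfer A B C E n) κ⁻¹ := by
  have hκ0 : 0 < κ := lt_of_le_of_lt (by positivity) hκ
  -- The expanded space consists of the initial data (w, 0), that is u_1 = w and u_0 = 0.
  refine le_numGT _
    ((LinearEquiv.sumArrowLequivProdArrow (Fin m) (Fin m) ℂ ℂ).symm.toLinearMap ∘ₗ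
      LinearMap.inl ℂ _ _) (by positivity) fun w hw => ?_
  have hLw : ((LinearEquiv.sumArrowLequivProdArrow (Fin m) (Fin m) ℂ ℂ).symm.toLinearMap ∘ₗ
      LinearMap.inl ℂ (Fin m → ℂ) (Fin m → ℂ)) w = Sum.elim w 0 := rfl
  rw [hLw, norm_toLp_sumElim_zero_right, transfer_mulVec]
  set u := solution A B C E (Sum.elim w 0)
  refine lt_of_lt_of_le ?_ (norm_toLp_le_sumElim_left _ _)
  have h0 : u 0 = 0 := (solution_zero _).trans (Sum.elim_comp_inr _ _)
  have h1 : u 1 = w := by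
    refine (solution_succ _ 0).trans ?_
    rw [transfer, Matrix.one_mulVec, Sum.elim_comp_inl]
  have h2 := solution_eq_of_solution_zero_eq_zero hl (i := i) hB hE h0
  rw [hi, zero_add] at h2
  have h3 : w = -((block (shifted n A B C E)⁻¹ i l * B n) *ᵥ u (n + 1)) := h1.symm.trans h2
  have hle : ‖WithLp.toLp 2 w‖ ≤
      ‖block (shifted n A B C E)⁻¹ i l‖ * ‖B n‖ * ‖WithLp.toLp 2 (u (n + 1))‖ := by
    rw [h3, WithLp.toLp_neg, norm_neg]
    exact (norm_toLp_mulVec_le _ _).trans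
      (mul_le_mul_of_nonneg_right (Matrix.l2_opNorm_mul _ _) (norm_nonneg _))
  have hne : u (n + 1) ≠ 0 := fun h => hw (by rw [h3, h, Matrix.mulVec_zero, neg_zero])
  rw [inv_mul_lt_iff₀ hκ0]
  exact hle.trans_lt (mul_lt_mul_of_pos_right hκ (norm_toLp_pos hne))

/-- Small singular values from a bound on the opposite corner block of the resolvent. -/
theorem le_numLT_transfer (hB : ∀ k ∈ Finset.Icc 1 n, IsUnit (B k))
    (hC : ∀ k ∈ Finset.Icc 1 n, IsUnit (C k))
    (hE : E ∉ spectrum ℂ (openChain n A B C)) {i l : Fin n} (hi : (i : ℕ) + 1 = n)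
    (hl : (l : ℕ) = 0) {κ : ℝ}
    (hκ : ‖block (shifted n A B C E)⁻¹ i l‖ * ‖C 1‖ < κ) :
    m ≤ numLT (transfer A B C E n) κ := by
  have hκ0 : 0 < κ := lt_of_le_of_lt (by positivity) hκ
  have hdet := (Matrix.isUnit_iff_isUnit_det _).mp
    (isUnit_transfer (A := A) (E := E) hB hC)
  -- The contracted space is prescribed at the far end: T v = (0, w), that is u_{n+1} = 0 and u_n =
  -- w.
  refine le_numLT _ ((transfer A B C E n)⁻¹.mulVecLin ∘ₗ
    (LinearEquiv.sumArrowLequivProdArrow (Fin m) (Fin m) ℂ ℂ).symm.toLinearMap ∘ₗ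
      LinearMap.inr ℂ _ _) hκ0.le fun w hw => ?_
  have hLw : ((transfer A B C E n)⁻¹.mulVecLin ∘ₗ
      (LinearEquiv.sumArrowLequivProdArrow (Fin m) (Fin m) ℂ ℂ).symm.toLinearMap ∘ₗ
      LinearMap.inr ℂ (Fin m → ℂ) (Fin m → ℂ)) w =
        (transfer A B C E n)⁻¹ *ᵥ Sum.elim 0 w := rfl
  rw [hLw]
  set v := (transfer A B C E n)⁻¹ *ᵥ Sum.elim 0 w with hv
  have hTv : transfer A B C E n *ᵥ v = Sum.elim (0 : Fin m → ℂ) w := by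
    rw [hv, Matrix.mulVec_mulVec, Matrix.mul_nonsing_inv _ hdet, Matrix.one_mulVec]
  rw [hTv, norm_toLp_sumElim_zero_left]
  set u := solution A B C E v
  have h0 : u (n + 1) = 0 := by
    refine (solution_succ v n).trans ?_
    rw [hTv, Sum.elim_comp_inl]
  have h1 : u n = w := by
    change _ ∘ _ = _
    rw [hTv, Sum.elim_comp_inr]
  have h2 := solution_eq_of_solution_succ_eq_zero hl (i := i) hB hE h0
  rw [hi] at h2
  have h3 : w = -((block (shifted n A B C E)⁻¹ i l * C 1) *ᵥ u 0) := h1.symm.trans h2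
  have hle : ‖WithLp.toLp 2 w‖ ≤
      ‖block (shifted n A B C E)⁻¹ i l‖ * ‖C 1‖ * ‖WithLp.toLp 2 (u 0)‖ := by
    rw [h3, WithLp.toLp_neg, norm_neg]
    exact (norm_toLp_mulVec_le _ _).trans
      (mul_le_mul_of_nonneg_right (Matrix.l2_opNorm_mul _ _) (norm_nonneg _))
  have hne : u 0 ≠ 0 := fun h => hw (by rw [h3, h, Matrix.mulVec_zero, neg_zero])
  refine hle.trans_lt ((mul_lt_mul_of_pos_right hκ (norm_toLp_pos hne)).trans_le ?_)
  refine mul_le_mul_of_nonneg_left ?_ hκ0.le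
  have h4 : u 0 = v ∘ Sum.inr := solution_zero v
  rw [h4, ← Sum.elim_comp_inl_inr v]
  exact norm_toLp_le_sumElim_right _ _

theorem dmsC_pos {ι : Type*} [Fintype ι] [DecidableEq ι] [Nonempty ι] {M : Matrix ι ι ℂ}
    (hM : IsUnit M) : 0 < dmsC M := by
  have := norm_pos_of_isUnit hM
  have : 0 ≤ cond M := by unfold cond; positivity
  unfold dmsC
  positivity

/-- With s = n - 2 the decay factor is q^{n/2 - 1}, strictly below q^{(n-3)/2}. This slack gives the
strict inequality needed for the counts; the factor m ≥ 1 is also slack. -/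
theorem mul_lt_const_mul_rpow {s : ℕ} (hm : 0 < m) (hs : s + 2 = n) {κ β S D q : ℝ} (hβ : 0 < β)
    (hS : 0 < S) (hD : 0 < D) (hq0 : 0 < q) (hq1 : q < 1)
    (h : κ ≤ S * (D * q ^ ((s : ℝ) / 2))) :
    κ * β < m * β * D * S * q ^ (-(3 / 2) : ℝ) * q ^ ((n : ℝ) / 2) := by
  have h1 : q ^ ((s : ℝ) / 2) < q ^ (-(3 / 2) : ℝ) * q ^ ((n : ℝ) / 2) := by
    rw [← Real.rpow_add hq0]
    refine Real.rpow_lt_rpow_of_exponent_gt hq0 hq1 ?_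
    rw [← hs]
    push_cast
    linarith
  have hm1 : (1 : ℝ) ≤ m := by exact_mod_cast hm
  calc κ * β ≤ S * (D * q ^ ((s : ℝ) / 2)) * β := mul_le_mul_of_nonneg_right h hβ.le
    _ = 1 * (β * D * S) * q ^ ((s : ℝ) / 2) := by ring
    _ < 1 * (β * D * S) * (q ^ (-(3 / 2) : ℝ) * q ^ ((n : ℝ) / 2)) :=
        mul_lt_mul_of_pos_left h1 (by positivity)
    _ ≤ m * (β * D * S) * (q ^ (-(3 / 2) : ℝ) * q ^ ((n : ℝ) / 2)) := by gcongr
    _ = _ := by ring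

/-- The first block column of h - E contains only A_1 - E and C_2, in rows 1 and 2; both rows are at
distance at least n - 2 from n. -/
theorem norm_block_mul_lt_constK (hm : 0 < m) (hn : 3 ≤ n)
    (hB : ∀ k ∈ Finset.Icc 1 n, IsUnit (B k)) (hC : ∀ k ∈ Finset.Icc 1 n, IsUnit (C k))
    (hE : E ∉ spectrum ℂ (openChain n A B C)) {i l : Fin n} (hi : (i : ℕ) = 0)
    (hl : (l : ℕ) + 1 = n) :
    ‖block (shifted n A B C E)⁻¹ i l‖ * ‖B n‖ <
      constK n A B C E * rate n A B C E ^ ((n : ℝ) / 2) := by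
  have : Nonempty (Fin m) := ⟨⟨0, hm⟩⟩
  have : Nonempty (Fin n) := ⟨i⟩
  have hM := isUnit_shifted hE
  have hc := one_lt_cond_shifted hm hn hB hC hE
  set i' : Fin n := ⟨1, by omega⟩
  have hii' : i ≠ i' := fun h => by rw [h] at hi; simp [i'] at hi
  have hzero : ∀ k, k ≠ i → k ≠ i' → block (shifted n A B C E) k i = 0 := fun k hk hk' => by
    have hk2 : (k : ℕ) ≠ 0 := fun h => hk (Fin.ext (by omega))
    have hk3 : (k : ℕ) ≠ 1 := fun h => hk' (Fin.ext (by simpa [i'] using h))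
    rw [block_shifted, if_neg hk.symm, if_neg (by omega), if_neg (by omega)]
  have h := norm_block_inv_le hM isBanded_shifted hc hii' hzero (s := n - 2) (j := l) (by omega)
    (Or.inl (by omega)) (Or.inl (by simp only [i']; omega))
  have hd : block (shifted n A B C E) i i = A 1 - Matrix.scalar (Fin m) E := by
    rw [block_shifted, if_pos rfl, hi]
  have ho : block (shifted n A B C E) i' i = C 2 := by
    rw [block_shifted, if_neg hii', if_neg (by omega), if_pos (by simp [i', hi])]
  rw [hd, ho] at h
  have hC2 : 0 < ‖C 2‖ := norm_pos_of_isUnit (hC 2 (by simp; omega))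
  exact mul_lt_const_mul_rpow hm (by omega) (norm_pos_of_isUnit (hB n (by simp; omega)))
    (by positivity) (dmsC_pos hM) (dmsQ_pos hc) (dmsQ_lt_one hc) h

/-- Mirror image: the last block column contains only A_n - E and B_{n-1}, in rows n and n - 1, at
distance at least n - 2 from row 1. -/
theorem norm_block_mul_lt_constKInv (hm : 0 < m) (hn : 3 ≤ n)
    (hB : ∀ k ∈ Finset.Icc 1 n, IsUnit (B k)) (hC : ∀ k ∈ Finset.Icc 1 n, IsUnit (C k))
    (hE : E ∉ spectrum ℂ (openChain n A B C)) {i l : Fin n} (hi : (i : ℕ) + 1 = n)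
    (hl : (l : ℕ) = 0) :
    ‖block (shifted n A B C E)⁻¹ i l‖ * ‖C 1‖ <
      constKInv n A B C E * rate n A B C E ^ ((n : ℝ) / 2) := by
  have : Nonempty (Fin m) := ⟨⟨0, hm⟩⟩
  have : Nonempty (Fin n) := ⟨i⟩
  have hM := isUnit_shifted hE
  have hc := one_lt_cond_shifted hm hn hB hC hE
  set i' : Fin n := ⟨n - 2, by omega⟩
  have hv' : (i' : ℕ) = n - 2 := rfl
  have hii' : i ≠ i' := fun h => by rw [h] at hi; omega
  have hzero : ∀ k, k ≠ i → k ≠ i' → block (shifted n A B C E) k i = 0 := fun k hk hk' => by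
    have hk2 : (k : ℕ) ≠ i := fun h => hk (Fin.ext h)
    have hk3 : (k : ℕ) ≠ i' := fun h => hk' (Fin.ext h)
    rw [block_shifted, if_neg hk.symm, if_neg (by omega), if_neg (by omega)]
  have h := norm_block_inv_le hM isBanded_shifted hc hii' hzero (s := n - 2) (j := l) (by omega)
    (Or.inr (by omega)) (Or.inr (by omega))
  have hd : block (shifted n A B C E) i i = A n - Matrix.scalar (Fin m) E := by
    rw [block_shifted, if_pos rfl, hi]
  have ho : block (shifted n A B C E) i' i = B (n - 1) := by
    rw [block_shifted, if_neg hii', if_pos (by omega), show (i' : ℕ) + 1 = n - 1 by omega]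
  rw [hd, ho] at h
  have hBn : 0 < ‖B (n - 1)‖ := norm_pos_of_isUnit (hB (n - 1) (by simp; omega))
  exact mul_lt_const_mul_rpow hm (by omega) (norm_pos_of_isUnit (hC 1 (by simp; omega)))
    (by positivity) (dmsC_pos hM) (dmsQ_pos hc) (dmsQ_lt_one hc) h

theorem rate_pos_and_lt_one (hm : 0 < m) (hn : 3 ≤ n)
    (hB : ∀ k ∈ Finset.Icc 1 n, IsUnit (B k)) (hC : ∀ k ∈ Finset.Icc 1 n, IsUnit (C k))
    (hE : E ∉ spectrum ℂ (openChain n A B C)) :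
    0 < rate n A B C E ∧ rate n A B C E < 1 :=
  have hc := one_lt_cond_shifted hm hn hB hC hE
  ⟨dmsQ_pos hc, dmsQ_lt_one hc⟩

theorem rpow_neg_div_eq_inv {q : ℝ} (hq : 0 < q) (K t : ℝ) :
    q ^ (-t / 2) / K = (K * q ^ (t / 2))⁻¹ := by
  rw [neg_div, Real.rpow_neg hq.le, mul_inv_rev, div_eq_mul_inv]

theorem constK_pos (hm : 0 < m) (hn : 3 ≤ n)
    (hB : ∀ k ∈ Finset.Icc 1 n, IsUnit (B k)) (hC : ∀ k ∈ Finset.Icc 1 n, IsUnit (C k))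
    (hE : E ∉ spectrum ℂ (openChain n A B C)) : 0 < constK n A B C E := by
  have h := norm_block_mul_lt_constK hm hn hB hC hE (i := ⟨0, by omega⟩) (l := ⟨n - 1, by omega⟩)
    rfl (by simp only; omega)
  exact pos_of_mul_pos_left (lt_of_le_of_lt (by positivity) h)
    (Real.rpow_nonneg (rate_pos_and_lt_one hm hn hB hC hE).1.le _)

theorem le_numGT_transfer_constK (hm : 0 < m) (hn : 3 ≤ n)
    (hB : ∀ k ∈ Finset.Icc 1 n, IsUnit (B k)) (hC : ∀ k ∈ Finset.Icc 1 n, IsUnit (C k))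
    (hE : E ∉ spectrum ℂ (openChain n A B C)) :
    m ≤ numGT (transfer A B C E n) (rate n A B C E ^ (-(n : ℝ) / 2) / constK n A B C E) := by
  rw [rpow_neg_div_eq_inv (rate_pos_and_lt_one hm hn hB hC hE).1]
  exact le_numGT_transfer hB hE (i := ⟨0, by omega⟩) (l := ⟨n - 1, by omega⟩)
    rfl (by simp only; omega)
    (norm_block_mul_lt_constK hm hn hB hC hE rfl (by simp only; omega))

theorem le_numLT_transfer_constKInv (hm : 0 < m) (hn : 3 ≤ n)
    (hB : ∀ k ∈ Finset.Icc 1 n, IsUnit (B k)) (hC : ∀ k ∈ Finset.Icc 1 n, IsUnit (C k))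
    (hE : E ∉ spectrum ℂ (openChain n A B C)) :
    m ≤ numLT (transfer A B C E n) (constKInv n A B C E * rate n A B C E ^ ((n : ℝ) / 2)) :=
  le_numLT_transfer hB hC hE (i := ⟨n - 1, by omega⟩) (l := ⟨0, by omega⟩)
    (by simp only; omega) rfl
    (norm_block_mul_lt_constKInv hm hn hB hC hE (by simp only; omega) rfl)

theorem numGT_eq_and_numLT_eq_of_constMax (hm : 0 < m) (hn : 3 ≤ n)
    (hB : ∀ k ∈ Finset.Icc 1 n, IsUnit (B k)) (hC : ∀ k ∈ Finset.Icc 1 n, IsUnit (C k))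
    (hE : E ∉ spectrum ℂ (openChain n A B C))
    (h : constMax n A B C E * rate n A B C E ^ ((n : ℝ) / 2) ≤ 1) :
    numGT (transfer A B C E n) (rate n A B C E ^ (-(n : ℝ) / 2) / constMax n A B C E) = m ∧
      numLT (transfer A B C E n) (constMax n A B C E * rate n A B C E ^ ((n : ℝ) / 2)) = m := by
  have hq := (rate_pos_and_lt_one hm hn hB hC hE).1
  have hK₁ := constK_pos hm hn hB hC hE
  have hK : 0 < constMax n A B C E := hK₁.trans_le (le_max_left _ _)
  refine numGT_eq_and_numLT_eq ?_
    ((le_numGT_transfer_constK hm hn hB hC hE).trans (numGT_anti _ ?_))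
    ((le_numLT_transfer_constKInv hm hn hB hC hE).trans (numLT_mono _ ?_))
  · rw [rpow_neg_div_eq_inv hq]
    -- The thresholds are reciprocal, hence separated by 1.
    exact h.trans (one_le_inv_iff₀.mpr ⟨by positivity, h⟩)
  · exact div_le_div_of_nonneg_left (by positivity) hK₁ (le_max_left _ _)
  · exact mul_le_mul_of_nonneg_right (le_max_right _ _) (by positivity)

theorem exists_forall_mul_rpow_le_one {q₀ : ℝ} (K₀ : ℝ) (hq₀ : q₀ < 1) :
    ∃ N : ℕ, ∀ n : ℕ, N ≤ n → ∀ q K : ℝ, 0 < q → q ≤ q₀ → 0 < K → K ≤ K₀ →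
      K * q ^ ((n : ℝ) / 2) ≤ 1 := by
  by_cases hpos : 0 < q₀ ∧ 0 < K₀
  swap
  -- If q₀ ≤ 0 or K₀ ≤ 0, no admissible pair (q, K) exists.
  · exact ⟨0, fun n _ q K hq hqq hK hKK =>
      absurd ⟨hq.trans_le hqq, hK.trans_le hKK⟩ hpos⟩
  obtain ⟨h0, hK0⟩ := hpos
  obtain ⟨N, hN⟩ := exists_pow_lt_of_lt_one (inv_pos.mpr hK0) hq₀
  -- `N` is doubled because the exponent is n/2.
  refine ⟨2 * N, fun n hn q K hq hqq hK hKK => ?_⟩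
  have hNn : (N : ℝ) ≤ (n : ℝ) / 2 := by
    have : ((2 * N : ℕ) : ℝ) ≤ n := by exact_mod_cast hn
    push_cast at this
    linarith
  calc K * q ^ ((n : ℝ) / 2) ≤ K₀ * q₀ ^ N := by
        refine mul_le_mul hKK ?_ (by positivity) hK0.le
        rw [← Real.rpow_natCast]
        exact (Real.rpow_le_rpow hq.le hqq (by positivity)).trans
          (Real.rpow_le_rpow_of_exponent_ge h0 hq₀.le hNn)
    _ ≤ K₀ * K₀⁻¹ := mul_le_mul_of_nonneg_left hN.le hK0.le
    _ = 1 := mul_inv_cancel₀ hK0.ne'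

end Bounds

end TransferMatrix

theorem mainTheorem1 :
    (∀ (m n : ℕ) (A B C : ℕ → Matrix (Fin m) (Fin m) ℂ) (E : ℂ),
      0 < m → 3 ≤ n →
      (∀ k ∈ Finset.Icc 1 n, IsUnit (B k)) → (∀ k ∈ Finset.Icc 1 n, IsUnit (C k)) →
      E ∉ spectrum ℂ (TransferMatrix.openChain n A B C) →
      let T := TransferMatrix.transfer A B C E n
      let q := TransferMatrix.rate n A B C E
      let K₁ := TransferMatrix.constK n A B C E
      let K₂ := TransferMatrix.constKInv n A B C E
      let K := TransferMatrix.constMax n A B C E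
      0 < q ∧ q < 1 ∧
      m ≤ TransferMatrix.numGT T (q ^ (-(n : ℝ) / 2) / K₁) ∧
      m ≤ TransferMatrix.numLT T (K₂ * q ^ ((n : ℝ) / 2)) ∧
      (K₁ * K₂ * q ^ n ≤ 1 →
        TransferMatrix.numGT T (q ^ (-(n : ℝ) / 2) / K₁) = m ∧
        TransferMatrix.numLT T (K₂ * q ^ ((n : ℝ) / 2)) = m) ∧
      (K * q ^ ((n : ℝ) / 2) ≤ 1 →
        TransferMatrix.numGT T (q ^ (-(n : ℝ) / 2) / K) = m ∧
        TransferMatrix.numLT T (K * q ^ ((n : ℝ) / 2)) = m)) ∧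
    (∀ q₀ K₀ : ℝ, q₀ < 1 → ∃ N : ℕ, ∀ n : ℕ, N ≤ n →
      ∀ (m : ℕ) (A B C : ℕ → Matrix (Fin m) (Fin m) ℂ) (E : ℂ),
      0 < m →
      (∀ k ∈ Finset.Icc 1 n, IsUnit (B k)) → (∀ k ∈ Finset.Icc 1 n, IsUnit (C k)) →
      E ∉ spectrum ℂ (TransferMatrix.openChain n A B C) →
      let T := TransferMatrix.transfer A B C E n
      let q := TransferMatrix.rate n A B C E
      let K := TransferMatrix.constMax n A B C E
      q ≤ q₀ → K ≤ K₀ →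
        TransferMatrix.numGT T (q ^ (-(n : ℝ) / 2) / K) = m ∧
        TransferMatrix.numLT T (K * q ^ ((n : ℝ) / 2)) = m) := by
  refine ⟨fun m n A B C E hm hn hB hC hE => ?_, fun q₀ K₀ hq₀ => ?_⟩
  · obtain ⟨hq, hq1⟩ := TransferMatrix.rate_pos_and_lt_one hm hn hB hC hE
    have hGT := TransferMatrix.le_numGT_transfer_constK hm hn hB hC hE
    have hLT := TransferMatrix.le_numLT_transfer_constKInv hm hn hB hC hE
    refine ⟨hq, hq1, hGT, hLT, fun h => TransferMatrix.numGT_eq_and_numLT_eq ?_ hGT hLT,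
      TransferMatrix.numGT_eq_and_numLT_eq_of_constMax hm hn hB hC hE⟩
    have hK₁ := TransferMatrix.constK_pos hm hn hB hC hE
    -- The hypothesis K₁K₂qⁿ ≤ 1 is precisely the ordering K₂q^{n/2} ≤ q^{-n/2}/K₁ of the
    -- thresholds.
    rw [TransferMatrix.rpow_neg_div_eq_inv hq, ← one_div, le_div_iff₀ (by positivity)]
    refine le_trans (le_of_eq ?_) h
    have hsq : TransferMatrix.rate n A B C E ^ n =
        TransferMatrix.rate n A B C E ^ ((n : ℝ) / 2) *
          TransferMatrix.rate n A B C E ^ ((n : ℝ) / 2) := by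
      rw [← Real.rpow_add hq, add_halves, Real.rpow_natCast]
    rw [hsq]
    ring
  · obtain ⟨N, hN⟩ := TransferMatrix.exists_forall_mul_rpow_le_one K₀ hq₀
    refine ⟨max N 3, fun n hn m A B C E hm hB hC hE => ?_⟩
    intro T q K hq hK
    have hn3 : 3 ≤ n := (le_max_right _ _).trans hn
    exact TransferMatrix.numGT_eq_and_numLT_eq_of_constMax hm hn3 hB hC hE
      (hN n ((le_max_left _ _).trans hn) q K
        (TransferMatrix.rate_pos_and_lt_one hm hn3 hB hC hE).1 hq
        ((TransferMatrix.constK_pos hm hn3 hB hC hE).trans_le (le_max_left _ _)) hK)
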